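/- A partition is called a $3$-core if none of the hook numbers of its Young diagram is a multiple of $3$ (the empty partition of $0$ is a $3$-core). For $n \ge 0$ let $B_3(n)$ denote the number of triples $(\lambda_1,\lambda_2,\lambda_3)$ of partitions such that each $\lambda_i$ is a $3$-core and the sum of all the parts of $\lambda_1,\lambda_2,\lambda_3$ equals $n$. Then for all integers $k \ge 1$ and $n \ge 0$, $$B_3\left(2^{k+1}n+2^k-1\right)=\frac{2^{2k+2}+(-1)^k}{5}\, B_3(2n)$$ and $$B_3\left(2^{k+1}n+2^{k+1}-1\right)=\frac{2^{2k+2}+(-1)^k}{5}\, B_3(2n+1)+\frac{2^{2k+2}-4(-1)^k}{5}\, B_3(n).$$ -/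

import Mathlib

namespace PartitionTriple

/-- The hook number of the cell in row `i` and column `j` (both counted from `0`) of the Young
diagram of a partition: the number of cells of the diagram to its right in the same row, plus the
number of cells below it in the same column, plus one for the cell itself.  It is only used for
cells of the diagram, where both subtractions are exact. -/
def hookNumber (μ : YoungDiagram) (i j : ℕ) : ℕ :=
  (μ.rowLen i - (j + 1)) + (μ.colLen j - (i + 1)) + 1

/-- A partition is a `t`-core if none of its hook numbers is a multiple of `t`. -/
def IsCore (t : ℕ) (μ : YoungDiagram) : Prop :=
  ∀ i j : ℕ, (i, j) ∈ μ → ¬ t ∣ hookNumber μ i j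

/-- The partition triples of `n` with `t`-cores.  Partitions are represented by their Young
diagrams, so that the sum of the parts of a partition is the number of cells of its diagram. -/
def coreTriples (t n : ℕ) : Set (YoungDiagram × YoungDiagram × YoungDiagram) :=
  {l | IsCore t l.1 ∧ IsCore t l.2.1 ∧ IsCore t l.2.2 ∧
    l.1.card + l.2.1.card + l.2.2.card = n}

/-- There are finitely many Young diagrams with at most `n` cells. -/
theorem finite_card_le (n : ℕ) : {μ : YoungDiagram | μ.card ≤ n}.Finite := by
  refine Set.Finite.of_finite_image (f := YoungDiagram.cells) ?_ ?_
  · refine Set.Finite.subset (Finset.finite_toSet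
      (Finset.range n ×ˢ Finset.range n).powerset) ?_
    rintro _ ⟨μ, hμ, rfl⟩
    rw [Finset.mem_coe, Finset.mem_powerset]
    rintro ⟨i, j⟩ hc
    have hm : (i, j) ∈ μ := hc
    have hr : μ.rowLen i ≤ μ.card := by
      rw [YoungDiagram.rowLen_eq_card]
      exact Finset.card_le_card (Finset.filter_subset _ _)
    have hl : μ.colLen j ≤ μ.card := by
      rw [YoungDiagram.colLen_eq_card]
      exact Finset.card_le_card (Finset.filter_subset _ _)
    have h1 := YoungDiagram.mem_iff_lt_rowLen.1 hm
    have h2 := YoungDiagram.mem_iff_lt_colLen.1 hm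
    have h3 : μ.card ≤ n := hμ
    simp only [Finset.mem_product, Finset.mem_range]
    omega
  · intro μ _ ν _ h
    exact YoungDiagram.ext h

/-- There are finitely many partition triples of `n` with `t`-cores, so counting them by
`Set.ncard` is meaningful. -/
theorem finite_coreTriples (t n : ℕ) : (coreTriples t n).Finite := by
  refine Set.Finite.subset
    ((finite_card_le n).prod ((finite_card_le n).prod (finite_card_le n))) ?_
  rintro ⟨a, b, c⟩ ⟨-, -, -, h⟩
  simp only [Set.mem_prod, Set.mem_ofPred_eq] at h ⊢
  omega

/-- `B t n` is the number of partition triples of `n` with `t`-cores. -/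
noncomputable def B (t n : ℕ) : ℕ := (coreTriples t n).ncard

end PartitionTriple

/-! Write A(q) for `coreSeries`, the sum of q^Q(b,c) over integer pairs, with Q = `coreForm`. On a
three-runner abacus a 3-core amounts to three charges with sum zero, and its size is Q of two of
them. So A counts 3-cores and A³ generates B_3 (`coeff_coreSeries_pow_three`).

Two facts about A carry the theorem. The first is arithmetic: Q(b,c) is odd only for (b,c) = (-2x,
-2y-1), where it equals 4Q(x,y)+1; hence A(q) = D(q²) + qA(q⁴) (`coreSeries_bisect`). The second is
a product formula: A(q)E(q) = E(q³)³ for Euler's product E (`coreSeries_mul_eulerProd`). With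
E(q)E(-q)E(q⁴) = E(q²)³ it gives A(q)A(-q)A(q⁴) = A(q²)³.

Putting the first fact into the last identity gives D(q)²A(q²) = A(q)³ + qA(q²)³, which eliminates D
from the odd part of A³: that part is q(3A(q²)³ + 4q²A(q⁴)³). Thus B(4n+1) = 3B(2n) and B(4n+3) =
3B(2n+1) + 4B(n). The sequence u_k = B(2^k m - 1) then obeys u_{k+2} = 3u_{k+1} + 4u_k, with
characteristic roots 4 and -1; the two claims are m = 2n+1 and m = n+1.

The product formula comes from a finite identity: splitting the factors of ∏(1 + p^j X) by j mod 3
and comparing the middle coefficients, then letting the length grow, working modulo powers of the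
variable. -/

namespace PartitionTriple

open Finset PowerSeries

/-! ### Gaussian binomials and finite product identities -/

section QBinomial

variable {R : Type*} [CommRing R]

/-- The finite product `(1 - p) (1 - p ^ 2) ⋯ (1 - p ^ n)`. -/
def qPoch (p : R) (n : ℕ) : R := ∏ i ∈ range n, (1 - p ^ (i + 1))

theorem qPoch_zero (p : R) : qPoch p 0 = 1 := by simp [qPoch]

theorem qPoch_succ (p : R) (n : ℕ) : qPoch p (n + 1) = qPoch p n * (1 - p ^ (n + 1)) := by
  simp [qPoch, prod_range_succ]

theorem map_qPoch {S F : Type*} [CommRing S] [FunLike F R S] [RingHomClass F R S] (f : F) (p : R)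
    (n : ℕ) : f (qPoch p n) = qPoch (f p) n := by
  simp [qPoch, map_prod]

/-- The Gaussian binomial coefficient with base `p`. -/
def qChoose (p : R) : ℕ → ℕ → R
  | _, 0 => 1
  | 0, _ + 1 => 0
  | n + 1, k + 1 => qChoose p n (k + 1) + p ^ (n - k) * qChoose p n k

theorem qChoose_zero_right (p : R) (n : ℕ) : qChoose p n 0 = 1 := by
  cases n <;> rfl

theorem qChoose_succ_succ (p : R) (n k : ℕ) :
    qChoose p (n + 1) (k + 1) = qChoose p n (k + 1) + p ^ (n - k) * qChoose p n k := rfl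

theorem qChoose_eq_zero (p : R) {n k : ℕ} (h : n < k) : qChoose p n k = 0 := by
  induction n generalizing k with
  | zero => cases k with
    | zero => omega
    | succ k => rfl
  | succ n ih => cases k with
    | zero => omega
    | succ k => rw [qChoose_succ_succ, ih (by omega), ih (by omega)]; ring

theorem map_qChoose {S F : Type*} [CommRing S] [FunLike F R S] [RingHomClass F R S] (f : F) (p : R)
    (n k : ℕ) : f (qChoose p n k) = qChoose (f p) n k := by
  induction n generalizing k with
  | zero => cases k with
    | zero => simp [qChoose_zero_right]
    | succ k => simp [qChoose_eq_zero]
  | succ n ih => cases k with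
    | zero => simp [qChoose_zero_right]
    | succ k => simp [qChoose_succ_succ, ih]

theorem qChoose_mul_qPoch (p : R) (n k : ℕ) :
    qChoose p (n + k) k * qPoch p k * qPoch p n = qPoch p (n + k) := by
  induction h : n + k using Nat.strong_induction_on generalizing n k with
  | _ m ih =>
    subst h
    cases k with
    | zero => simp [qChoose_zero_right, qPoch_zero]
    | succ k =>
      cases n with
      | zero =>
        have := ih k (by omega) 0 k (by omega)
        rw [qPoch_zero] at this ⊢
        rw [zero_add]
        rw [qChoose_succ_succ, qChoose_eq_zero p (Nat.lt_succ_self k), qPoch_succ, Nat.sub_self]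
        linear_combination (1 - p ^ (k + 1)) * this
      | succ n =>
        have h1 := ih (n + k + 1) (by omega) n (k + 1) (by omega)
        have h2 := ih (n + k + 1) (by omega) (n + 1) k (by omega)
        have e1 : n + 1 + (k + 1) = n + k + 1 + 1 := by omega
        rw [e1, qChoose_succ_succ, qPoch_succ p (n + k + 1),
          show n + k + 1 - k = n + 1 by omega]
        rw [qPoch_succ p k] at h1 ⊢
        rw [qPoch_succ p n] at h2 ⊢
        linear_combination (1 - p ^ (n + 1)) * h1 + p ^ (n + 1) * (1 - p ^ (k + 1)) * h2

/-- The `q`-binomial theorem. -/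
theorem coeff_prod_one_add (u p : R) (n k : ℕ) :
    (∏ j ∈ range n, (1 + Polynomial.C (u * p ^ j) * Polynomial.X)).coeff k =
      u ^ k * p ^ (k.choose 2) * qChoose p n k := by
  induction n generalizing k with
  | zero => cases k with
    | zero => simp [qChoose_zero_right]
    | succ k => simp [qChoose_eq_zero, Polynomial.coeff_one]
  | succ n ih =>
    rw [prod_range_succ, mul_add, mul_one, ← mul_assoc, Polynomial.coeff_add]
    cases k with
    | zero =>
      rw [Polynomial.mul_coeff_zero _ Polynomial.X, Polynomial.coeff_X_zero, mul_zero, add_zero, ih,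
        qChoose_zero_right, qChoose_zero_right]
    | succ k =>
      rw [Polynomial.coeff_mul_X, Polynomial.coeff_mul_C, ih, ih, qChoose_succ_succ,
        Nat.choose_succ_succ' k 1, Nat.choose_one_right]
      -- The exponent n - k is truncated only for k > n, where the Gaussian binomial it multiplies
      -- is zero.
      rcases le_or_gt k n with h | h
      · obtain ⟨d, rfl⟩ := Nat.exists_eq_add_of_le h
        rw [Nat.add_sub_cancel_left]
        ring
      · rw [qChoose_eq_zero p h]; ring

theorem natDegree_prod_one_add_le (u p : R) (n : ℕ) :
    (∏ j ∈ range n, (1 + Polynomial.C (u * p ^ j) * Polynomial.X)).natDegree < n + 1 := by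
  rw [Nat.lt_succ_iff, Polynomial.natDegree_le_iff_coeff_eq_zero]
  intro k hk
  rw [coeff_prod_one_add, qChoose_eq_zero p hk, mul_zero]

theorem prod_one_add_eq_sum (u p : R) (n : ℕ) :
    ∏ j ∈ range n, (1 + Polynomial.C (u * p ^ j) * Polynomial.X) =
      ∑ k ∈ range (n + 1), Polynomial.C (u ^ k * p ^ (k.choose 2) * qChoose p n k) *
        Polynomial.X ^ k := by
  conv_lhs => rw [Polynomial.as_sum_range_C_mul_X_pow' _ (natDegree_prod_one_add_le u p n)]
  simp only [coeff_prod_one_add]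

theorem prod_range_three_mul {M : Type*} [CommMonoid M] (f : ℕ → M) (n : ℕ) :
    ∏ i ∈ range (3 * n), f i = (∏ i ∈ range n, f (3 * i)) * (∏ i ∈ range n, f (3 * i + 1)) *
      ∏ i ∈ range n, f (3 * i + 2) := by
  induction n with
  | zero => simp
  | succ n ih =>
    rw [show 3 * (n + 1) = 3 * n + 1 + 1 + 1 by ring]
    simp only [prod_range_succ, ih]
    ac_rfl

theorem prod_one_add_trisect (p : R) (n : ℕ) :
    ∏ j ∈ range (3 * n), (1 + Polynomial.C (1 * p ^ j) * Polynomial.X) =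
      (∏ j ∈ range n, (1 + Polynomial.C (1 * (p ^ 3) ^ j) * Polynomial.X)) *
      (∏ j ∈ range n, (1 + Polynomial.C (p * (p ^ 3) ^ j) * Polynomial.X)) *
      (∏ j ∈ range n, (1 + Polynomial.C (p ^ 2 * (p ^ 3) ^ j) * Polynomial.X)) := by
  rw [prod_range_three_mul]
  refine congr_arg₂ _ (congr_arg₂ _ ?_ ?_) ?_ <;> refine prod_congr rfl fun j _ => ?_ <;>
    congr 3 <;> ring

/-- The trisection of a Gaussian binomial coefficient. -/
theorem qChoose_trisect (p : R) (N : ℕ) :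
    p ^ ((3 * N).choose 2) * qChoose p (6 * N) (3 * N) =
      ∑ x ∈ (range (2 * N + 1) ×ˢ range (2 * N + 1)) with
          x.1 + x.2 ≤ 3 * N ∧ 3 * N - (x.1 + x.2) ≤ 2 * N,
        p ^ (x.1 + 2 * x.2 + 3 * ((3 * N - (x.1 + x.2)).choose 2 + x.1.choose 2 + x.2.choose 2)) *
          (qChoose (p ^ 3) (2 * N) (3 * N - (x.1 + x.2)) * qChoose (p ^ 3) (2 * N) x.1 *
            qChoose (p ^ 3) (2 * N) x.2) := by
  have h := congr_arg (fun f => Polynomial.coeff f (3 * N)) (prod_one_add_trisect p (2 * N))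
  rw [← mul_assoc, show 3 * 2 = 6 by rfl, coeff_prod_one_add, one_pow, one_mul] at h
  rw [h, prod_one_add_eq_sum p, prod_one_add_eq_sum (p ^ 2), mul_assoc, sum_mul_sum, mul_sum,
    Polynomial.finsetSum_coeff, sum_filter, sum_product]
  refine sum_congr rfl fun b _ => ?_
  rw [mul_sum, Polynomial.finsetSum_coeff]
  refine sum_congr rfl fun c _ => ?_
  rw [show ∀ f : Polynomial R, ∀ s t : R, f * (Polynomial.C s * Polynomial.X ^ b *
    (Polynomial.C t * Polynomial.X ^ c)) = Polynomial.C (s * t) * (f * Polynomial.X ^ (b + c)) by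
    intro f s t; rw [map_mul]; ring, Polynomial.coeff_C_mul, Polynomial.coeff_mul_X_pow']
  rcases le_or_gt (b + c) (3 * N) with h1 | h1
  · rw [if_pos h1, coeff_prod_one_add]
    rcases le_or_gt (3 * N - (b + c)) (2 * N) with h2 | h2
    · rw [if_pos ⟨h1, h2⟩]
      ring
    · rw [if_neg (fun h => absurd h.2 (by omega)), qChoose_eq_zero _ h2]
      ring
  · rw [if_neg (by omega), if_neg (by simp only; omega), mul_zero]

/-- For odd i the factors at x and -x combine to 1 - x^(2i); for even i they give (1 - x^i)². The
factors of `qPoch (x ^ 4) n` supply the terms of `qPoch (x ^ 2) (2 * n)` of even index. -/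
theorem qPoch_mul_qPoch_neg (x : R) (n : ℕ) :
    qPoch x (2 * n) * qPoch (-x) (2 * n) * qPoch (x ^ 4) n =
      qPoch (x ^ 2) n ^ 2 * qPoch (x ^ 2) (2 * n) := by
  induction n with
  | zero => simp [qPoch_zero]
  | succ n ih =>
    rw [show 2 * (n + 1) = 2 * n + 1 + 1 by ring]
    simp only [qPoch_succ]
    have e1 : (-x) ^ (2 * n + 1) = - x ^ (2 * n + 1) := Odd.neg_pow ⟨n, rfl⟩ x
    have e2 : (-x) ^ (2 * n + 1 + 1) = x ^ (2 * n + 1 + 1) := Even.neg_pow ⟨n + 1, by ring⟩ x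
    rw [e1, e2]
    linear_combination ih * (1 - x ^ (2 * n + 1)) * (1 - x ^ (2 * n + 1 + 1)) ^ 2 *
      (1 + x ^ (2 * n + 1)) * (1 - (x ^ 4) ^ (n + 1))

end QBinomial

/-! ### Euler's product and truncation modulo powers of X -/

/-- Euler's product `(1 - X) (1 - X ^ 2) (1 - X ^ 3) ⋯`. -/
noncomputable def eulerProd : ℤ⟦X⟧ := PowerSeries.mk fun n => coeff n (qPoch (X : ℤ⟦X⟧) n)

theorem X_pow_dvd_qPoch_sub {m n : ℕ} (h : m ≤ n) :
    (X : ℤ⟦X⟧) ^ (m + 1) ∣ qPoch X n - qPoch X m := by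
  induction n, h using Nat.le_induction with
  | base => simp
  | succ n h ih =>
    rw [qPoch_succ, show qPoch (X : ℤ⟦X⟧) n * (1 - X ^ (n + 1)) - qPoch X m =
      (qPoch X n - qPoch X m) - X ^ (n + 1) * qPoch X n by ring]
    exact dvd_sub ih (Dvd.dvd.mul_right (pow_dvd_pow _ (by omega)) _)

theorem X_pow_dvd_qPoch_sub_eulerProd {m n : ℕ} (h : m ≤ n) :
    (X : ℤ⟦X⟧) ^ (m + 1) ∣ qPoch X n - eulerProd := by
  rw [X_pow_dvd_iff]
  intro i hi
  have := X_pow_dvd_iff.1 (X_pow_dvd_qPoch_sub (show i ≤ n by omega)) i (by omega)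
  rw [map_sub] at this ⊢
  rw [eulerProd, coeff_mk]
  exact this

/-- Reduction modulo `X ^ m`. -/
noncomputable def red (m : ℕ) : ℤ⟦X⟧ →+* ℤ⟦X⟧ ⧸ Ideal.span {(X : ℤ⟦X⟧) ^ m} :=
  Ideal.Quotient.mk _

theorem red_eq_iff {m : ℕ} {f g : ℤ⟦X⟧} : red m f = red m g ↔ X ^ m ∣ f - g := by
  rw [red, Ideal.Quotient.eq, Ideal.mem_span_singleton]

theorem eq_of_red_eq {f g : ℤ⟦X⟧} (h : ∀ m, red (m + 1) f = red (m + 1) g) : f = g := by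
  ext n
  have := X_pow_dvd_iff.1 (red_eq_iff.1 (h n)) n (by omega)
  rwa [map_sub, sub_eq_zero] at this

theorem red_X_pow {m n : ℕ} (h : m ≤ n) : red m (X ^ n) = 0 := by
  rw [← map_zero (red m), red_eq_iff, sub_zero]
  exact pow_dvd_pow _ h

theorem red_expand {k : ℕ} (hk : k ≠ 0) {m : ℕ} {f g : ℤ⟦X⟧} (h : red m f = red m g) :
    red m (expand k hk f) = red m (expand k hk g) := by
  rw [red_eq_iff] at h ⊢
  have := map_dvd (expand k hk) h
  rw [map_pow, expand_X, map_sub, ← pow_mul] at this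
  exact (pow_dvd_pow _ (Nat.le_mul_of_pos_left m (Nat.pos_of_ne_zero hk))).trans this

theorem red_evalNegHom {m : ℕ} {f g : ℤ⟦X⟧} (h : red m f = red m g) :
    red m (evalNegHom f) = red m (evalNegHom g) := by
  rw [red_eq_iff] at h ⊢
  have := map_dvd (evalNegHom (A := ℤ)) h
  rw [map_pow, evalNegHom_X, map_sub] at this
  refine Dvd.dvd.trans ?_ this
  rw [neg_pow]
  exact Dvd.intro_left _ rfl

theorem red_eulerProd {m n : ℕ} (h : m ≤ n) :
    red (m + 1) eulerProd = red (m + 1) (qPoch X n) :=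
  (red_eq_iff.2 (X_pow_dvd_qPoch_sub_eulerProd h)).symm

theorem isUnit_eulerProd : IsUnit eulerProd := by
  rw [isUnit_iff_constantCoeff, ← coeff_zero_eq_constantCoeff_apply, eulerProd, coeff_mk,
    qPoch_zero]
  simp

theorem eulerProd_mul_evalNeg :
    eulerProd * evalNegHom eulerProd * expand 4 (by norm_num) eulerProd =
      expand 2 (by norm_num) eulerProd ^ 3 := by
  refine eq_of_red_eq fun m => ?_
  have h1 := red_eulerProd (show m ≤ m by omega)
  have h2 := red_eulerProd (show m ≤ 2 * m by omega)
  have h3 := red_evalNegHom h2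
  have h4 := red_expand (show 4 ≠ 0 by norm_num) h1
  have h5 := red_expand (show 2 ≠ 0 by norm_num) h1
  have h6 := red_expand (show 2 ≠ 0 by norm_num) h2
  rw [pow_succ (expand 2 _ _), map_mul (red _), map_mul (red _), map_mul (red _), map_pow (red _), h3, h4, h2, ← map_mul (red _), ← map_mul (red _)]
  -- The finite identity needs two of the three factors E(q²) truncated at m and the third at 2m.
  nth_rw 1 [h5]
  rw [h6, ← map_pow, ← map_mul]
  simp only [map_qPoch, expand_X, evalNegHom_X]
  rw [qPoch_mul_qPoch_neg]

/-- Deep inside the range a Gaussian binomial is a quotient E / (E · E) up to the truncation order.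
-/
theorem red_qChoose_mul_eulerProd {m n k : ℕ} (hn : m ≤ n) (hk : m ≤ k) :
    red (m + 1) (qChoose X (n + k) k * eulerProd) = 1 := by
  have h := congr_arg (red (m + 1)) (qChoose_mul_qPoch (X : ℤ⟦X⟧) n k)
  rw [map_mul, map_mul, ← red_eulerProd hn, ← red_eulerProd hk,
    ← red_eulerProd (show m ≤ n + k by omega)] at h
  have hu := isUnit_eulerProd.map (red (m + 1))
  rw [map_mul]
  exact hu.mul_right_cancel (by rw [h, one_mul])

theorem red_qChoose_three_mul_eulerProd {m n k : ℕ} (hn : m ≤ n) (hk : m ≤ k) :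
    red (m + 1) (qChoose (X ^ 3) (n + k) k * expand 3 (by norm_num) eulerProd) = 1 := by
  have h := red_qChoose_mul_eulerProd hn hk
  rw [← map_one (red (m + 1))] at h
  have := red_expand (show 3 ≠ 0 by norm_num) h
  rwa [map_mul, map_qChoose, expand_X, map_one, map_one] at this

/-! ### Product formula for the theta series of `coreForm` -/

/-- The quadratic polynomial giving the size of the `3`-core with charges `-(b + c)`, `b`, `c`. -/
def coreForm (v : ℤ × ℤ) : ℤ :=
  3 * (v.1 ^ 2 + v.1 * v.2 + v.2 ^ 2) + v.1 + 2 * v.2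

theorem abs_le_coreForm (v : ℤ × ℤ) :
    |v.1| ≤ 2 * coreForm v ∧ |v.2| ≤ 2 * coreForm v ∧ |v.1 + v.2| ≤ 2 * coreForm v := by
  obtain ⟨b, c⟩ := v
  simp only [coreForm]
  have key : 2 * (3 * (b ^ 2 + b * c + c ^ 2) + b + 2 * c) =
    3 * b ^ 2 + (3 * c ^ 2 + 2 * c) + (3 * (b + c) ^ 2 + 2 * (b + c)) := by ring
  have aux : ∀ x : ℤ, |x| ≤ 3 * x ^ 2 + 2 * x := by
    intro x
    rcases lt_trichotomy x 0 with h | h | h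
    · rw [abs_of_neg h]; nlinarith
    · subst h; simp
    · rw [abs_of_pos h]; nlinarith
  have aux' : |b| ≤ 3 * b ^ 2 := by
    rw [← sq_abs]
    have := abs_nonneg b
    rcases eq_or_lt_of_le this with h | h
    · rw [← h]; norm_num
    · nlinarith
  have h1 := aux c
  have h2 := aux (b + c)
  have := abs_nonneg b
  have := abs_nonneg c
  have := abs_nonneg (b + c)
  rw [key]
  refine ⟨?_, ?_, ?_⟩ <;> linarith

theorem coreForm_nonneg (v : ℤ × ℤ) : 0 ≤ coreForm v := by
  have := (abs_le_coreForm v).1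
  have := abs_nonneg v.1
  linarith

/-- The generating function of the representation numbers of `coreForm`. -/
noncomputable def coreSeries : ℤ⟦X⟧ :=
  PowerSeries.mk fun n => ({v : ℤ × ℤ | coreForm v = n}.ncard : ℤ)

theorem qChoose_trisect_coreForm (N : ℕ) :
    qChoose (X : ℤ⟦X⟧) (6 * N) (3 * N) =
      ∑ x ∈ (range (2 * N + 1) ×ˢ range (2 * N + 1)) with
          x.1 + x.2 ≤ 3 * N ∧ 3 * N - (x.1 + x.2) ≤ 2 * N,
        X ^ (coreForm ((x.1 : ℤ) - N, (x.2 : ℤ) - N)).toNat *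
          (qChoose (X ^ 3) (2 * N) (3 * N - (x.1 + x.2)) * qChoose (X ^ 3) (2 * N) x.1 *
            qChoose (X ^ 3) (2 * N) x.2) := by
  have h := qChoose_trisect (X : ℤ⟦X⟧) N
  refine mul_left_cancel₀ (pow_ne_zero ((3 * N).choose 2) (X_ne_zero (R := ℤ))) ?_
  rw [h, mul_sum]
  refine sum_congr rfl fun x hx => ?_
  obtain ⟨b, c⟩ := x
  simp only [mem_filter] at hx ⊢
  obtain ⟨a, ha⟩ := Nat.exists_eq_add_of_le hx.2.1
  rw [← mul_assoc (X ^ (3 * N).choose 2), ← pow_add]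
  congr 2
  rw [show 3 * N - (b + c) = a by omega]
  have e : ((coreForm ((b : ℤ) - N, (c : ℤ) - N)).toNat : ℤ) =
    coreForm ((b : ℤ) - N, (c : ℤ) - N) := Int.toNat_of_nonneg (coreForm_nonneg _)
  -- Over ℚ each `choose 2` becomes a polynomial, so the comparison of exponents is a ring identity.
  -- Centring the indices at N is what produces `coreForm`.
  have e' : ((coreForm ((b : ℤ) - N, (c : ℤ) - N)).toNat : ℚ) =
      3 * (((b : ℚ) - N) ^ 2 + (b - N) * (c - N) + (c - N) ^ 2) + (b - N) + 2 * (c - N) := by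
    rw [← Int.cast_natCast, e, coreForm]
    push_cast
    ring
  have ha' : (3 * N : ℚ) = b + c + a := by exact_mod_cast ha
  have : ((b + 2 * c + 3 * (a.choose 2 + b.choose 2 + c.choose 2) : ℕ) : ℚ) =
      (((3 * N).choose 2 + (coreForm ((b : ℤ) - N, (c : ℤ) - N)).toNat : ℕ) : ℚ) := by
    push_cast [Nat.cast_choose_two, e']
    have : (a : ℚ) = 3 * N - b - c := by linarith
    rw [this]
    ring
  exact_mod_cast this

/-- Values at most m occur only for coordinates, and coordinate sums, of size at most 2m. With N ≥
3m these points lie in the shifted box and at least m from its ends; the extra margin is what the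
Gaussian binomials need in `coreSeries_mul_eulerProd`. -/
theorem red_coreSeries {m N : ℕ} (hN : 3 * m ≤ N) :
    red (m + 1) coreSeries =
      red (m + 1) (∑ x ∈ (range (2 * N + 1) ×ˢ range (2 * N + 1)) with
          x.1 + x.2 ≤ 3 * N ∧ 3 * N - (x.1 + x.2) ≤ 2 * N,
        X ^ (coreForm ((x.1 : ℤ) - N, (x.2 : ℤ) - N)).toNat) := by
  rw [red_eq_iff, X_pow_dvd_iff]
  intro j hj
  rw [map_sub, sub_eq_zero, coreSeries, coeff_mk, map_sum]
  simp only [coeff_X_pow]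
  rw [sum_boole, Nat.cast_inj]
  set T := (range (2 * N + 1) ×ˢ range (2 * N + 1)).filter fun x : ℕ × ℕ =>
    x.1 + x.2 ≤ 3 * N ∧ 3 * N - (x.1 + x.2) ≤ 2 * N with hT
  have hinj : Function.Injective fun x : ℕ × ℕ => ((x.1 : ℤ) - N, (x.2 : ℤ) - N) := by
    rintro ⟨a, b⟩ ⟨c, d⟩ h
    simp only [Prod.mk.injEq] at h ⊢
    omega
  rw [← card_image_of_injective _ hinj, ← Set.ncard_coe_finset]
  congr 1
  ext ⟨b, c⟩
  simp only [Set.mem_ofPred_eq, coe_image, coe_filter, Set.mem_image, Prod.exists, Prod.mk.injEq]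
  constructor
  · intro h
    have hb := abs_le_coreForm (b, c)
    simp only [abs_le] at hb
    have e1 : ((b + N).toNat : ℤ) - N = b := by omega
    have e2 : ((c + N).toNat : ℤ) - N = c := by omega
    refine ⟨(b + N).toNat, (c + N).toNat, ⟨?_, ?_⟩, e1, e2⟩
    · simp only [hT, mem_filter, mem_product, mem_range]
      omega
    · rw [e1, e2, h, Int.toNat_natCast]
  · rintro ⟨x, y, ⟨-, h⟩, rfl, rfl⟩
    rw [h, Int.toNat_of_nonneg (coreForm_nonneg _)]

theorem coreSeries_mul_eulerProd :
    coreSeries * eulerProd = expand 3 (by norm_num) eulerProd ^ 3 := by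
  refine eq_of_red_eq fun m => ?_
  obtain ⟨N, hN⟩ : ∃ N, 3 * m ≤ N := ⟨_, le_rfl⟩
  have h0 := red_qChoose_mul_eulerProd (show m ≤ 3 * N by omega) (show m ≤ 3 * N by omega)
  rw [show 3 * N + 3 * N = 6 * N by omega, qChoose_trisect_coreForm] at h0
  rw [mul_comm, map_mul, red_coreSeries hN, ← map_mul, ← one_mul (red (m + 1) (expand _ _ _ ^ 3)),
    ← h0, ← map_mul, mul_right_comm, mul_comm _ eulerProd, map_mul, map_mul]
  congr 1
  rw [sum_mul, map_sum, map_sum]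
  refine sum_congr rfl fun x hx => ?_
  rw [mul_assoc, map_mul]
  -- Terms of large exponent vanish modulo X^(m+1). In the others all three Gaussian binomials are
  -- deep in their range, and each cancels one factor E(q³).
  rcases le_or_gt (m + 1) (coreForm ((x.1 : ℤ) - N, (x.2 : ℤ) - N)).toNat with h | h
  · rw [red_X_pow h, zero_mul]
  · have hb := abs_le_coreForm ((x.1 : ℤ) - N, (x.2 : ℤ) - N)
    simp only [abs_le, mem_filter, mem_product, mem_range] at hb hx
    have h1 : coreForm ((x.1 : ℤ) - N, (x.2 : ℤ) - N) < m + 1 := by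
      have := Int.self_le_toNat (coreForm ((x.1 : ℤ) - N, (x.2 : ℤ) - N))
      omega
    have hc : ∀ k, m ≤ k → m + k ≤ 2 * N →
        red (m + 1) (qChoose (X ^ 3) (2 * N) k * expand 3 (by norm_num) eulerProd) = 1 := by
      intro k hk hk'
      have := red_qChoose_three_mul_eulerProd (show m ≤ 2 * N - k by omega) hk
      rwa [Nat.sub_add_cancel (by omega)] at this
    have c1 := hc x.1 (by omega) (by omega)
    have c2 := hc x.2 (by omega) (by omega)
    have c3 := hc (3 * N - (x.1 + x.2)) (by omega) (by omega)
    rw [show ∀ s t u e : ℤ⟦X⟧, s * t * u * e ^ 3 = (s * e) * (t * e) * (u * e) by intros; ring,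
      map_mul, map_mul, c1, c2, c3]
    simp

/-! ### The relation between A(q), A(-q), A(q²) and A(q⁴) -/

theorem expand_comm {j k : ℕ} (hj : j ≠ 0) (hk : k ≠ 0) (f : ℤ⟦X⟧) :
    expand j hj (expand k hk f) = expand k hk (expand j hj f) := by
  rw [← expand_mul, ← expand_mul]
  simp only [mul_comm]

theorem evalNegHom_expand_three (f : ℤ⟦X⟧) :
    evalNegHom (expand 3 (by norm_num) f) = expand 3 (by norm_num) (evalNegHom f) := by
  ext n
  simp only [evalNegHom, coeff_rescale, coeff_expand]
  split_ifs with h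
  · obtain ⟨k, rfl⟩ := h
    rw [Nat.mul_div_cancel_left k (by norm_num), pow_mul]
    norm_num
  · simp

theorem coreSeries_mul_evalNeg :
    coreSeries * evalNegHom coreSeries * expand 4 (by norm_num) coreSeries =
      expand 2 (by norm_num) coreSeries ^ 3 := by
  have h := coreSeries_mul_eulerProd
  have hneg := congr_arg evalNegHom h
  have h4 := congr_arg (expand 4 (by norm_num)) h
  have h2 := congr_arg (expand 2 (by norm_num)) h
  have hE := eulerProd_mul_evalNeg
  have hE3 := congr_arg (expand 3 (by norm_num)) hE
  simp only [map_mul, map_pow] at hneg h4 h2 hE3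
  rw [evalNegHom_expand_three] at hneg
  rw [expand_comm (by norm_num : 4 ≠ 0) (by norm_num : 3 ≠ 0)] at h4
  rw [expand_comm (by norm_num : 2 ≠ 0) (by norm_num : 3 ≠ 0)] at h2
  refine ((isUnit_eulerProd.map (expand 2 two_ne_zero)).pow 3).mul_right_cancel ?_
  rw [← mul_pow, h2, ← hE3, ← hE]
  simp only [mul_pow, ← h, ← hneg, ← h4]
  ring

end PartitionTriple

/-! ### The abacus: 3-cores as pairs of charges -/

namespace PartitionTriple

open Finset

/-- The positions of the beads on the abacus of a partition. -/
def bead (μ : YoungDiagram) (i : ℕ) : ℤ := (μ.rowLen i : ℤ) - i - 1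

theorem bead_strictAnti (μ : YoungDiagram) : StrictAnti (bead μ) := by
  refine strictAnti_nat_of_succ_lt fun i => ?_
  have := μ.rowLen_anti i (i + 1) (by omega)
  simp only [bead]
  push_cast
  omega

theorem rowLen_le_iff_colLen_le {μ : YoungDiagram} {i j : ℕ} :
    μ.rowLen i ≤ j ↔ μ.colLen j ≤ i := by
  rw [← not_lt, ← not_lt, ← YoungDiagram.mem_iff_lt_rowLen, YoungDiagram.mem_iff_lt_colLen]

theorem bead_ne_gap (μ : YoungDiagram) (i j : ℕ) : bead μ i ≠ (j : ℤ) - μ.colLen j := by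
  intro h
  have := rowLen_le_iff_colLen_le (μ := μ) (i := i) (j := j)
  simp only [bead] at h
  omega

/-- Rows give the beads and columns give the gaps. If row i is the first whose bead lies at or below
y, then column y + i has length exactly i. -/
theorem exists_gap {μ : YoungDiagram} {y : ℤ} (h : y ∉ Set.range (bead μ)) :
    ∃ j : ℕ, y = (j : ℤ) - μ.colLen j := by
  have hex : ∃ i : ℕ, bead μ i ≤ y := by
    refine ⟨μ.rowLen 0 + y.natAbs, ?_⟩
    have := μ.rowLen_anti 0 (μ.rowLen 0 + y.natAbs) (by omega)
    simp only [bead]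
    omega
  classical
  obtain ⟨i, hi, hmin⟩ : ∃ i, bead μ i ≤ y ∧ ∀ k < i, ¬ bead μ k ≤ y :=
    ⟨Nat.find hex, Nat.find_spec hex, fun k hk => Nat.find_min hex hk⟩
  have hlt : bead μ i < y := lt_of_le_of_ne hi fun e => h ⟨i, e⟩
  have hlt' : (μ.rowLen i : ℤ) - i - 1 < y := hlt
  refine ⟨(y + i).toNat, ?_⟩
  have h1 := rowLen_le_iff_colLen_le (μ := μ) (i := i) (j := (y + i).toNat)
  rcases i with _ | k
  · omega
  · have h2 := rowLen_le_iff_colLen_le (μ := μ) (i := k) (j := (y + (k + 1 : ℕ)).toNat)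
    have h3 := hmin k (by omega)
    simp only [bead] at h3
    omega

/-- A partition is a `t`-core if and only if its beads cannot be moved down by `t`. -/
theorem isCore_iff {t : ℕ} (ht : 0 < t) (μ : YoungDiagram) :
    IsCore t μ ↔ ∀ x ∈ Set.range (bead μ), x - t ∈ Set.range (bead μ) := by
  constructor
  · rintro h _ ⟨i, rfl⟩
    by_contra hx
    obtain ⟨j, hj⟩ := exists_gap hx
    simp only [bead] at hj
    have h1 := rowLen_le_iff_colLen_le (μ := μ) (i := i) (j := j)
    have hm : j < μ.rowLen i := by omega
    refine h i j (YoungDiagram.mem_iff_lt_rowLen.2 hm) ?_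
    -- A hook number is the bead of its row minus the gap of its column.
    rw [show hookNumber μ i j = t by simp only [hookNumber]; omega]
  · rintro h i j hm ⟨k, hk⟩
    -- A hook number t·k would put the gap of column j exactly k moves below the bead of row i, yet
    -- every such position is occupied.
    have key : ∀ k : ℕ, bead μ i - t * k ∈ Set.range (bead μ) := by
      intro k
      induction k with
      | zero => exact ⟨i, by simp⟩
      | succ k ih =>
        have := h _ ih
        rwa [show bead μ i - t * k - t = bead μ i - t * (k + 1 : ℕ) by push_cast; ring] at this
    obtain ⟨l, hl⟩ := key k
    refine bead_ne_gap μ l j ?_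
    have h1 := YoungDiagram.mem_iff_lt_rowLen.1 hm
    have h2 := YoungDiagram.mem_iff_lt_colLen.1 hm
    have hk' : ((hookNumber μ i j : ℕ) : ℤ) = t * k := by exact_mod_cast hk
    rw [hl, ← hk']
    simp only [bead, hookNumber]
    omega

theorem card_eq_sum_rowLen (μ : YoungDiagram) {K : ℕ} (hK : μ.rowLen K = 0) :
    μ.card = ∑ i ∈ range K, μ.rowLen i := by
  rw [YoungDiagram.card, card_eq_sum_card_fiberwise (f := Prod.fst) (t := range K)]
  · exact sum_congr rfl fun i _ => (μ.rowLen_eq_card).symm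
  · rintro ⟨i, j⟩ hc
    have h1 := YoungDiagram.mem_iff_lt_rowLen.1 (show (i, j) ∈ μ from hc)
    simp only [coe_range, Set.mem_Iio]
    by_contra h
    have := μ.rowLen_anti K i (by omega)
    omega

/-- The charge of the runner `r` of the abacus. -/
def charge (v : ℤ × ℤ) (r : ℤ) : ℤ := if r = 0 then -(v.1 + v.2) else if r = 1 then v.1 else v.2

/-- The beads of the `3`-core with given charges. -/
def beadSet (c : ℤ → ℤ) : Set ℤ := {x | x / 3 < c (x % 3)}

theorem sum_beadSet {F : Finset ℤ} {c : ℤ → ℤ} {M : ℤ}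
    (hF : ∀ x, x ∈ F ↔ -3 * M ≤ x ∧ x ∈ beadSet c) (h : ℤ → ℤ) :
    ∑ x ∈ F, h x = ∑ j ∈ Ico (-M) (c 0), h (3 * j) + ∑ j ∈ Ico (-M) (c 1), h (3 * j + 1) +
      ∑ j ∈ Ico (-M) (c 2), h (3 * j + 2) := by
  have hr : ∀ r : ℤ, 0 ≤ r → r < 3 →
      ∑ x ∈ F with x % 3 = r, h x = ∑ j ∈ Ico (-M) (c r), h (3 * j + r) := by
    intro r h0 h3
    refine sum_nbij' (fun x => x / 3) (fun j => 3 * j + r) ?_ ?_ ?_ ?_ ?_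
    · intro x hx
      simp only [mem_filter, hF, beadSet, Set.mem_ofPred_eq, mem_Ico] at hx ⊢
      obtain ⟨⟨h1, h2⟩, rfl⟩ := hx
      omega
    · intro j hj
      simp only [mem_filter, hF, beadSet, Set.mem_ofPred_eq, mem_Ico] at hj ⊢
      have e1 : (3 * j + r) / 3 = j := by omega
      have e2 : (3 * j + r) % 3 = r := by omega
      rw [e1, e2]
      omega
    · intro x hx
      simp only [mem_filter] at hx
      omega
    · intro j _
      omega
    · intro x hx
      simp only [mem_filter] at hx
      congr 1
      omega
  have h0 := hr 0 (by norm_num) (by norm_num)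
  simp only [add_zero] at h0
  rw [← h0, ← hr 1 (by norm_num) (by norm_num), ← hr 2 (by norm_num) (by norm_num)]
  simp only [sum_filter, ← sum_add_distrib]
  refine sum_congr rfl fun x _ => ?_
  rcases (by omega : x % 3 = 0 ∨ x % 3 = 1 ∨ x % 3 = 2) with e | e | e <;> simp [e]

theorem two_mul_sum_Ico (r : ℤ) {a c : ℤ} (h : a ≤ c) :
    2 * ∑ j ∈ Ico a c, (3 * j + r) = 3 * (c * (c - 1) - a * (a - 1)) + 2 * r * (c - a) := by
  induction c, h using Int.leInduction with
  | base => simp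
  | succ c h ih =>
    rw [← Finset.insert_Ico_right_eq_Ico_add_one h, sum_insert (by simp), mul_add, ih]
    ring

/-- The beads of a partition up to position `-K`. -/
theorem mem_image_bead {μ : YoungDiagram} {K : ℕ} (hK : μ.rowLen K = 0) (x : ℤ) :
    x ∈ (range K).image (bead μ) ↔ -(K : ℤ) ≤ x ∧ x ∈ Set.range (bead μ) := by
  simp only [mem_image, mem_range, Set.mem_range]
  constructor
  · rintro ⟨i, hi, rfl⟩
    refine ⟨?_, i, rfl⟩
    simp only [bead]
    omega
  · rintro ⟨h, i, rfl⟩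
    refine ⟨i, ?_, rfl⟩
    by_contra hi
    have := μ.rowLen_anti K i (by omega)
    simp only [bead] at h
    omega

theorem exists_rowLen_eq_zero (μ : YoungDiagram) (m : ℕ) :
    ∃ M : ℕ, m ≤ M ∧ μ.rowLen (3 * M) = 0 := by
  refine ⟨m + μ.colLen 0, by omega, ?_⟩
  have := rowLen_le_iff_colLen_le (μ := μ) (i := 3 * (m + μ.colLen 0)) (j := 0)
  omega

/-- Cut the abacus at -3M, so that each runner starts at height -M. Counting the 3M remaining beads
shows that the charges sum to zero; summing their positions gives the size. -/
theorem charge_and_card_of_beads {μ : YoungDiagram} {c : ℤ → ℤ}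
    (h : Set.range (bead μ) = beadSet c) :
    c 0 + c 1 + c 2 = 0 ∧ (μ.card : ℤ) = coreForm (c 1, c 2) := by
  obtain ⟨M, hM, hrow⟩ :=
    exists_rowLen_eq_zero μ ((c 0).natAbs + (c 1).natAbs + (c 2).natAbs)
  have hF : ∀ x, x ∈ (range (3 * M)).image (bead μ) ↔ -3 * (M : ℤ) ≤ x ∧ x ∈ beadSet c := by
    intro x
    rw [mem_image_bead hrow, h]
    push_cast
    rw [neg_mul]
  have hinj : Set.InjOn (bead μ) (range (3 * M)) := (bead_strictAnti μ).injective.injOn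
  have e1 := sum_beadSet hF (fun _ => 1)
  have e2 := sum_beadSet hF (fun x => x)
  rw [sum_image hinj] at e1 e2
  simp only [sum_const, card_range, Int.card_Ico, nsmul_eq_mul, mul_one] at e1
  have hsum : c 0 + c 1 + c 2 = 0 := by
    push_cast at e1
    omega
  refine ⟨hsum, ?_⟩
  have t0 := two_mul_sum_Ico 0 (show -(M : ℤ) ≤ c 0 by omega)
  have t1 := two_mul_sum_Ico 1 (show -(M : ℤ) ≤ c 1 by omega)
  have t2 := two_mul_sum_Ico 2 (show -(M : ℤ) ≤ c 2 by omega)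
  simp only [add_zero] at t0
  have hcard : (μ.card : ℤ) = ∑ i ∈ range (3 * M), bead μ i + ∑ i ∈ range (3 * M), ((i : ℤ) + 1) := by
    rw [card_eq_sum_rowLen μ hrow, ← sum_add_distrib]
    push_cast
    refine sum_congr rfl fun i _ => ?_
    simp only [bead]
    ring
  have hgauss : ∀ n : ℕ, 2 * ∑ i ∈ range n, ((i : ℤ) + 1) = n * (n + 1) := by
    intro n
    induction n with
    | zero => simp
    | succ n ih => rw [sum_range_succ, mul_add, ih]; push_cast; ring
  have hg := hgauss (3 * M)
  push_cast at hg
  have h0 : c 0 = -(c 1 + c 2) := by omega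
  rw [h0] at t0 e2
  simp only [coreForm]
  linarith

/-- Each runner is closed downwards by the core condition, bounded above, and occupied far below, so
it is filled up to a threshold. -/
theorem exists_charge {μ : YoungDiagram} (h : IsCore 3 μ) :
    ∃ c : ℤ → ℤ, Set.range (bead μ) = beadSet c := by
  rw [isCore_iff (by norm_num)] at h
  have key : ∀ r : ℤ, ∃ g : ℤ, 0 ≤ r → r < 3 → ∀ j : ℤ, 3 * j + r ∈ Set.range (bead μ) ↔ j < g := by
    intro r
    by_cases hr : 0 ≤ r ∧ r < 3
    swap
    · exact ⟨0, fun h1 h2 => absurd ⟨h1, h2⟩ hr⟩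
    obtain ⟨M, -, hrow⟩ := exists_rowLen_eq_zero μ 0
    obtain ⟨g, hg, hmax⟩ := Int.exists_greatest_of_bdd
      (P := fun j : ℤ => 3 * j + r ∈ Set.range (bead μ)) ⟨μ.rowLen 0, by
        rintro j ⟨i, hi⟩
        have := μ.rowLen_anti 0 i (by omega)
        simp only [bead] at hi
        omega⟩ ⟨-M - 1, (3 * M + 2 - r).toNat, by
          have := μ.rowLen_anti (3 * M) (3 * M + 2 - r).toNat (by omega)
          simp only [bead]
          omega⟩
    refine ⟨g + 1, fun _ _ j => ⟨fun hj => by have := hmax j hj; omega, fun hj => ?_⟩⟩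
    have hdown : ∀ k : ℕ, 3 * (g - k) + r ∈ Set.range (bead μ) := by
      intro k
      induction k with
      | zero => simpa using hg
      | succ k ih =>
        have := h _ ih
        rwa [show 3 * (g - k) + r - (3 : ℕ) = 3 * (g - (k + 1 : ℕ)) + r by push_cast; ring] at this
    have := hdown (g - j).toNat
    rwa [Int.toNat_of_nonneg (by omega), sub_sub_cancel] at this
  choose c hc using key
  refine ⟨c, ?_⟩
  ext x
  rw [beadSet, Set.mem_ofPred_eq, ← hc (x % 3) (by omega) (by omega), Int.mul_ediv_add_emod]

theorem exists_youngDiagram_rowLen {w : ℕ → ℕ} (hw : Antitone w) {K : ℕ} (hK : w K = 0) :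
    ∃ μ : YoungDiagram, ∀ i, μ.rowLen i = w i := by
  have hmem : ∀ i j : ℕ, (i, j) ∈ ((range K ×ˢ range (w 0)).filter fun c => c.2 < w c.1) ↔
      j < w i := by
    intro i j
    simp only [mem_filter, mem_product, mem_range, and_iff_right_iff_imp]
    intro h
    have := hw (Nat.zero_le i)
    refine ⟨?_, by omega⟩
    by_contra hi
    have := hw (not_lt.1 hi)
    omega
  refine ⟨⟨(range K ×ˢ range (w 0)).filter fun c => c.2 < w c.1, ?_⟩, fun i => ?_⟩
  · rintro ⟨i, j⟩ ⟨i', j'⟩ ⟨h1, h2⟩ h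
    rw [mem_coe, hmem] at h ⊢
    have h3 : w i ≤ w i' := hw h1
    have h4 : j' ≤ j := h2
    omega
  · refine eq_of_forall_lt_iff fun j => ?_
    rw [← YoungDiagram.mem_iff_lt_rowLen]
    exact hmem i j

theorem exists_youngDiagram_beads (F : Finset ℤ) (hF : ∀ x ∈ F, -(F.card : ℤ) ≤ x) :
    ∃ μ : YoungDiagram, ∀ x, x ∈ Set.range (bead μ) ↔ x ∈ F ∨ x < -(F.card : ℤ) := by
  obtain ⟨K, hK⟩ : ∃ K, F.card = K := ⟨_, rfl⟩
  rw [hK] at hF ⊢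
  set f := F.orderEmbOfFin hK
  -- The i-th smallest of K distinct integers that are at least -K is at least -K + i; this makes
  -- the row lengths below nonnegative.
  have hlow : ∀ i : ℕ, ∀ h : i < K, -(K : ℤ) + i ≤ f ⟨i, h⟩ := by
    intro i
    induction i with
    | zero => intro h; simpa using hF _ (F.orderEmbOfFin_mem hK _)
    | succ i ih =>
      intro h
      have h1 := ih (by omega)
      have h2 : f ⟨i, by omega⟩ < f ⟨i + 1, h⟩ := f.strictMono (by simp)
      push_cast
      omega
  set w : ℕ → ℕ := fun i => if h : i < K then (f ⟨K - 1 - i, by omega⟩ + i + 1).toNat else 0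
  have hw : ∀ i : ℕ, ∀ h : i < K, (w i : ℤ) = f ⟨K - 1 - i, by omega⟩ + i + 1 := by
    intro i h
    simp only [w, dif_pos h]
    have := hlow (K - 1 - i) (by omega)
    omega
  have hw0 : ∀ i : ℕ, K ≤ i → w i = 0 := fun i h => dif_neg (by omega)
  have hanti : Antitone w := by
    refine antitone_nat_of_succ_le fun i => ?_
    rcases lt_or_ge (i + 1) K with h | h
    · have h1 := hw i (by omega)
      have h2 := hw (i + 1) h
      have h3 : f ⟨K - 1 - (i + 1), by omega⟩ < f ⟨K - 1 - i, by omega⟩ :=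
        f.strictMono (by simp only [Fin.mk_lt_mk]; omega)
      push_cast at h2
      omega
    · rw [hw0 _ h]; omega
  obtain ⟨μ, hμ⟩ := exists_youngDiagram_rowLen hanti (hw0 K le_rfl)
  refine ⟨μ, fun x => ⟨?_, ?_⟩⟩
  · rintro ⟨i, rfl⟩
    rw [bead, hμ]
    rcases lt_or_ge i K with h | h
    · left
      rw [hw i h, add_sub_assoc, add_sub_assoc]
      convert F.orderEmbOfFin_mem hK ⟨K - 1 - i, by omega⟩ using 1
      simp only [f]
      ring
    · right
      rw [hw0 i h]
      omega
  · rintro (h | h)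
    · rw [← mem_coe, ← F.range_orderEmbOfFin hK] at h
      obtain ⟨⟨k, hk⟩, rfl⟩ := h
      refine ⟨K - 1 - k, ?_⟩
      rw [bead, hμ, hw _ (by omega)]
      have : K - 1 - (K - 1 - k) = k := by omega
      simp only [this, f]
      ring
    · refine ⟨(-x - 1).toNat, ?_⟩
      rw [bead, hμ, hw0 _ (by omega)]
      omega

theorem exists_core_beads (v : ℤ × ℤ) :
    ∃ μ : YoungDiagram, Set.range (bead μ) = beadSet (charge v) := by
  obtain ⟨b, c⟩ := v
  set M : ℕ := (b.natAbs + c.natAbs) with hM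
  have c0 : charge (b, c) 0 = -(b + c) := rfl
  have c1 : charge (b, c) 1 = b := rfl
  have c2 : charge (b, c) 2 = c := rfl
  have hlt : ∀ x : ℤ, |charge (b, c) x| ≤ M := by
    intro x
    rw [abs_le, charge]
    split_ifs <;> simp only <;> omega
  classical
  set F := (Ico (-3 * (M : ℤ)) (3 * M)).filter (· ∈ beadSet (charge (b, c))) with hFdef
  have hF : ∀ x, x ∈ F ↔ -3 * (M : ℤ) ≤ x ∧ x ∈ beadSet (charge (b, c)) := by
    intro x
    rw [hFdef, mem_filter, mem_Ico]
    have := hlt (x % 3)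
    rw [abs_le] at this
    constructor
    · rintro ⟨⟨h1, -⟩, h2⟩; exact ⟨h1, h2⟩
    · rintro ⟨h1, h2⟩
      refine ⟨⟨h1, ?_⟩, h2⟩
      rw [beadSet, Set.mem_ofPred_eq] at h2
      omega
  -- The three runners contribute M plus their charge, and the charges sum to zero.
  have hcard : F.card = 3 * M := by
    have e := sum_beadSet hF (fun _ => 1)
    simp only [sum_const, Int.card_Ico, nsmul_eq_mul, mul_one, c0, c1, c2] at e
    omega
  obtain ⟨μ, hμ⟩ := exists_youngDiagram_beads F fun x hx => by
    have := ((hF x).1 hx).1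
    rw [hcard]
    push_cast
    omega
  refine ⟨μ, ?_⟩
  ext x
  rw [hμ, hF, hcard]
  push_cast
  constructor
  · rintro (h | h)
    · exact h.2
    · have := hlt (x % 3)
      rw [abs_le] at this
      rw [beadSet, Set.mem_ofPred_eq]
      omega
  · intro h
    rcases lt_or_ge x (-3 * (M : ℤ)) with h' | h'
    · right; omega
    · left; exact ⟨h', h⟩

theorem eq_of_range_bead_eq {μ ν : YoungDiagram} (h : Set.range (bead μ) = Set.range (bead ν)) :
    μ = ν := by
  have hb : bead μ = bead ν := by
    have := (bead_strictAnti μ).dual_right.range_inj (bead_strictAnti ν).dual_right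
    exact this.1 h
  refine YoungDiagram.ext (Finset.ext fun ⟨i, j⟩ => ?_)
  rw [YoungDiagram.mem_cells, YoungDiagram.mem_cells, YoungDiagram.mem_iff_lt_rowLen,
    YoungDiagram.mem_iff_lt_rowLen]
  have := congr_fun hb i
  simp only [bead] at this
  omega

theorem beadSet_congr {c d : ℤ → ℤ} (h0 : c 0 = d 0) (h1 : c 1 = d 1) (h2 : c 2 = d 2) :
    beadSet c = beadSet d := by
  ext x
  simp only [beadSet, Set.mem_ofPred_eq]
  rcases (by omega : x % 3 = 0 ∨ x % 3 = 1 ∨ x % 3 = 2) with e | e | e <;> rw [e] <;> simp only [*]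

theorem eq_of_beadSet_eq {c d : ℤ → ℤ} (h : beadSet c = beadSet d) {r : ℤ} (h0 : 0 ≤ r)
    (h3 : r < 3) : c r = d r := by
  refine eq_of_forall_lt_iff fun j => ?_
  have := Set.ext_iff.1 h (3 * j + r)
  simp only [beadSet, Set.mem_ofPred_eq] at this
  rwa [show (3 * j + r) / 3 = j by omega, show (3 * j + r) % 3 = r by omega] at this

/-- The `3`-core with given charges. -/
noncomputable def coreOf (v : ℤ × ℤ) : YoungDiagram := (exists_core_beads v).choose

theorem range_bead_coreOf (v : ℤ × ℤ) : Set.range (bead (coreOf v)) = beadSet (charge v) :=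
  (exists_core_beads v).choose_spec

theorem card_coreOf (v : ℤ × ℤ) : ((coreOf v).card : ℤ) = coreForm v :=
  (charge_and_card_of_beads (range_bead_coreOf v)).2

theorem isCore_coreOf (v : ℤ × ℤ) : IsCore 3 (coreOf v) := by
  rw [isCore_iff (by norm_num), range_bead_coreOf]
  intro x hx
  simp only [beadSet, Set.mem_ofPred_eq] at hx ⊢
  rw [show (x - (3 : ℕ)) % 3 = x % 3 by omega]
  omega

theorem coreOf_injective : Function.Injective coreOf := by
  rintro v w h
  have := range_bead_coreOf v
  rw [h, range_bead_coreOf] at this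
  exact Prod.ext (eq_of_beadSet_eq this (r := 1) (by norm_num) (by norm_num)).symm
    (eq_of_beadSet_eq this (r := 2) (by norm_num) (by norm_num)).symm

theorem exists_coreOf_eq {μ : YoungDiagram} (h : IsCore 3 μ) : ∃ v, coreOf v = μ := by
  obtain ⟨c, hc⟩ := exists_charge h
  refine ⟨(c 1, c 2), eq_of_range_bead_eq ?_⟩
  rw [range_bead_coreOf, hc]
  have := (charge_and_card_of_beads hc).1
  refine beadSet_congr ?_ rfl rfl
  simp only [charge, if_true]
  omega

end PartitionTriple

/-! ### Generating functions of weights -/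

namespace PartitionTriple

open Finset PowerSeries

/-- The generating function of a weight function. -/
noncomputable def weightSeries {α : Type*} (f : α → ℕ) : ℤ⟦X⟧ :=
  PowerSeries.mk fun n => ({a | f a = n}.ncard : ℤ)

theorem setOf_add_eq {α β : Type*} (f : α → ℕ) (g : β → ℕ) (n : ℕ) :
    {p : α × β | f p.1 + g p.2 = n} =
      ⋃ ij ∈ antidiagonal n, {a | f a = ij.1} ×ˢ {b | g b = ij.2} := by
  ext ⟨a, b⟩
  simp only [Set.mem_ofPred_eq, Set.mem_iUnion, Set.mem_prod, HasAntidiagonal.mem_antidiagonal, exists_prop]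
  exact ⟨fun h => ⟨(f a, g b), h, rfl, rfl⟩, by rintro ⟨ij, h, h1, h2⟩; rw [h1, h2, h]⟩

theorem finite_setOf_add_eq {α β : Type*} {f : α → ℕ} {g : β → ℕ}
    (hf : ∀ n, {a | f a = n}.Finite) (hg : ∀ n, {b | g b = n}.Finite) (n : ℕ) :
    {p : α × β | f p.1 + g p.2 = n}.Finite := by
  rw [setOf_add_eq]
  exact (antidiagonal n).finite_toSet.biUnion fun ij _ => (hf ij.1).prod (hg ij.2)

/-- Finiteness of the fibres is essential, since `Set.ncard` is zero on infinite sets. -/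
theorem weightSeries_mul {α β : Type*} {f : α → ℕ} {g : β → ℕ}
    (hf : ∀ n, {a | f a = n}.Finite) (hg : ∀ n, {b | g b = n}.Finite) :
    weightSeries f * weightSeries g = weightSeries fun p : α × β => f p.1 + g p.2 := by
  classical
  ext n
  rw [coeff_mul, weightSeries, weightSeries, weightSeries, coeff_mk]
  have e : {p : α × β | f p.1 + g p.2 = n} =
      ↑((antidiagonal n).biUnion fun ij => (hf ij.1).toFinset ×ˢ (hg ij.2).toFinset) := by
    rw [setOf_add_eq]
    simp
  rw [e, Set.ncard_coe_finset, card_biUnion]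
  · push_cast
    refine sum_congr rfl fun ij _ => ?_
    rw [coeff_mk, coeff_mk, card_product, Set.ncard_eq_toFinset_card _ (hf ij.1),
      Set.ncard_eq_toFinset_card _ (hg ij.2)]
    push_cast
    rfl
  · intro x _ y _ hxy
    rw [Function.onFun, disjoint_left]
    rintro ⟨a, b⟩ h1 h2
    simp only [mem_product, Set.Finite.mem_toFinset, Set.mem_ofPred_eq] at h1 h2
    exact hxy (Prod.ext (h1.1.symm.trans h2.1) (h1.2.symm.trans h2.2))

theorem weightSeries_card_coreOf : weightSeries (fun v => (coreOf v).card) = coreSeries := by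
  ext n
  rw [weightSeries, coreSeries, coeff_mk, coeff_mk]
  congr 3
  ext v
  rw [← card_coreOf, Nat.cast_inj]

theorem finite_card_coreOf_eq (n : ℕ) : {v | (coreOf v).card = n}.Finite :=
  ((finite_card_le n).subset fun _ h => le_of_eq h : {μ : YoungDiagram | μ.card = n}.Finite).preimage
    coreOf_injective.injOn

/-- The generating function of triples of `3`-cores is the cube of that of `3`-cores. -/
theorem coeff_coreSeries_pow_three (n : ℕ) : coeff n (coreSeries ^ 3) = (B 3 n : ℤ) := by
  have hf := finite_card_coreOf_eq
  rw [pow_succ', pow_two, ← weightSeries_card_coreOf, weightSeries_mul hf hf,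
    weightSeries_mul hf (finite_setOf_add_eq hf hf), weightSeries, coeff_mk, B]
  have hinj : Function.Injective
      (Prod.map coreOf (Prod.map coreOf coreOf)) :=
    coreOf_injective.prodMap (coreOf_injective.prodMap coreOf_injective)
  rw [← Set.ncard_image_of_injective _ hinj]
  congr 2
  ext ⟨x, y, z⟩
  simp only [coreTriples, Set.mem_image, Set.mem_ofPred_eq, Prod.exists, Prod.map_apply,
    Prod.mk.injEq]
  constructor
  · rintro ⟨a, b, c, d, e, f, h, rfl, rfl, rfl⟩
    exact ⟨isCore_coreOf _, isCore_coreOf _, isCore_coreOf _, by omega⟩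
  · rintro ⟨hx, hy, hz, h⟩
    obtain ⟨⟨a, b⟩, rfl⟩ := exists_coreOf_eq hx
    obtain ⟨⟨c, d⟩, rfl⟩ := exists_coreOf_eq hy
    obtain ⟨⟨e, f⟩, rfl⟩ := exists_coreOf_eq hz
    exact ⟨a, b, c, d, e, f, by omega, rfl, rfl, rfl⟩

/-! ### Bisection of A and of its cube -/

/-- Modulo 2 the form is c(b + 1). -/
theorem even_and_odd_of_coreForm_odd {b c n : ℤ} (h : coreForm (b, c) = 2 * n + 1) :
    ∃ x y : ℤ, b = -2 * x ∧ c = -2 * y - 1 := by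
  simp only [coreForm] at h
  rcases Int.even_or_odd' b with ⟨x, rfl | rfl⟩ <;> rcases Int.even_or_odd' c with ⟨y, rfl | rfl⟩
  · ring_nf at h; omega
  · exact ⟨-x, -y - 1, by ring, by ring⟩
  · ring_nf at h; omega
  · ring_nf at h; omega

theorem coreForm_neg_two_mul (x y : ℤ) :
    coreForm (-2 * x, -2 * y - 1) = 4 * coreForm (x, y) + 1 := by
  simp only [coreForm]
  ring

theorem coeff_coreSeries_four_mul_add_one (n : ℕ) :
    coeff (4 * n + 1) coreSeries = coeff n coreSeries := by
  rw [coreSeries, coeff_mk, coeff_mk]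
  have hinj : Function.Injective fun v : ℤ × ℤ => (-2 * v.1, -2 * v.2 - 1) := by
    rintro ⟨a, b⟩ ⟨c, d⟩ h
    simp only [Prod.mk.injEq] at h ⊢
    omega
  rw [← Set.ncard_image_of_injective {v : ℤ × ℤ | coreForm v = n} hinj]
  congr 2
  ext ⟨b, c⟩
  simp only [Set.mem_image, Set.mem_ofPred_eq, Prod.exists, Prod.mk.injEq]
  constructor
  · intro h
    obtain ⟨x, y, rfl, rfl⟩ := even_and_odd_of_coreForm_odd (n := 2 * n)
      (by rw [h]; push_cast; ring)
    rw [coreForm_neg_two_mul] at h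
    exact ⟨x, y, by omega, rfl, rfl⟩
  · rintro ⟨x, y, h, rfl, rfl⟩
    rw [coreForm_neg_two_mul, h]
    push_cast
    ring

theorem coeff_coreSeries_four_mul_add_three (n : ℕ) : coeff (4 * n + 3) coreSeries = 0 := by
  rw [coreSeries, coeff_mk, Nat.cast_eq_zero]
  convert Set.ncard_empty (ℤ × ℤ)
  refine Set.eq_empty_of_forall_notMem ?_
  rintro ⟨b, c⟩ h
  rw [Set.mem_ofPred_eq] at h
  obtain ⟨x, y, rfl, rfl⟩ := even_and_odd_of_coreForm_odd (n := 2 * n + 1)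
    (by rw [h]; push_cast; ring)
  rw [coreForm_neg_two_mul] at h
  push_cast at h
  omega

/-- The terms of even degree of `coreSeries`. -/
noncomputable def coreSeriesEven : ℤ⟦X⟧ := PowerSeries.mk fun n => coeff (2 * n) coreSeries

theorem coreSeries_bisect :
    coreSeries = expand 2 two_ne_zero coreSeriesEven + X * expand 4 four_ne_zero coreSeries := by
  ext n
  rw [map_add, coeff_expand]
  rcases n with _ | n
  · simp [coreSeriesEven]
  rw [coeff_succ_X_mul, coeff_expand]
  rcases (by omega : (n + 1) % 2 = 0 ∨ (n + 1) % 4 = 1 ∨ (n + 1) % 4 = 3) with h | h | h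
  · rw [if_pos (by omega), if_neg (by omega), coreSeriesEven, coeff_mk, add_zero,
      Nat.mul_div_cancel' (by omega)]
  · rw [if_neg (by omega), if_pos (by omega), zero_add, ← coeff_coreSeries_four_mul_add_one (n / 4),
      show 4 * (n / 4) + 1 = n + 1 by omega]
  · rw [if_neg (by omega), if_neg (by omega), show n + 1 = 4 * (n / 4) + 3 by omega,
      coeff_coreSeries_four_mul_add_three, zero_add]

theorem evalNegHom_expand_of_even {k : ℕ} (hk : k ≠ 0) (h : Even k) (f : ℤ⟦X⟧) :
    evalNegHom (expand k hk f) = expand k hk f := by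
  ext n
  simp only [evalNegHom, coeff_rescale, coeff_expand]
  split_ifs with hd
  · obtain ⟨m, rfl⟩ := hd
    rw [(h.mul_right m).neg_one_pow, one_mul]
  · simp

theorem expand_two_two (f : ℤ⟦X⟧) :
    expand 2 two_ne_zero (expand 2 two_ne_zero f) = expand 4 four_ne_zero f := by
  rw [← expand_mul]

/-- After q ↦ q² this is the relation `coreSeries_mul_evalNeg` with A(±q) = D(q²) ± qA(q⁴) inserted;
injectivity of the substitution removes it. -/
theorem coreSeries_pow_three_add :
    coreSeries ^ 3 + X * expand 2 two_ne_zero coreSeries ^ 3 =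
      coreSeriesEven ^ 2 * expand 2 two_ne_zero coreSeries := by
  have h := coreSeries_mul_evalNeg
  have hneg : evalNegHom coreSeries =
      expand 2 two_ne_zero coreSeriesEven - X * expand 4 four_ne_zero coreSeries := by
    conv_lhs => rw [coreSeries_bisect]
    rw [map_add, map_mul, evalNegHom_X, evalNegHom_expand_of_even _ (by decide),
      evalNegHom_expand_of_even _ (by decide)]
    ring
  rw [hneg] at h
  nth_rw 1 [coreSeries_bisect] at h
  have hinj : Function.Injective (expand 2 two_ne_zero : ℤ⟦X⟧ →ₐ[ℤ] ℤ⟦X⟧) := by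
    intro f g hfg
    ext n
    rw [← coeff_expand_mul 2 two_ne_zero f, hfg, coeff_expand_mul]
  refine hinj ?_
  simp only [map_add, map_mul, map_pow, expand_X, expand_two_two]
  linear_combination -h

theorem coreSeries_pow_three_bisect :
    coreSeries ^ 3 =
      expand 2 two_ne_zero
        (coreSeriesEven ^ 3 + 3 * X * coreSeriesEven * expand 2 two_ne_zero coreSeries ^ 2) +
      X * expand 2 two_ne_zero
        (3 * coreSeries ^ 3 + 4 * (X * expand 2 two_ne_zero (coreSeries ^ 3))) := by
  have h := congr_arg (expand 2 two_ne_zero) coreSeries_pow_three_add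
  conv_lhs => rw [coreSeries_bisect]
  simp only [map_add, map_mul, map_pow, expand_X, expand_two_two, map_ofNat] at h ⊢
  -- The cube of the bisection has odd part 3qD(q²)²A(q⁴) + q³A(q⁴)³; `h` replaces D(q²)²A(q⁴).
  linear_combination -3 * X * h

/-! ### Recurrences for B_3 and their solution -/

theorem B_three_two_mul_add_one (m : ℕ) :
    (B 3 (2 * m + 1) : ℤ) =
      3 * B 3 m + 4 * coeff m (X * expand 2 two_ne_zero (coreSeries ^ 3)) := by
  rw [← coeff_coreSeries_pow_three, ← coeff_coreSeries_pow_three]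
  conv_lhs => rw [coreSeries_pow_three_bisect]
  rw [map_add, coeff_expand_of_not_dvd _ _ _ (by omega), coeff_succ_X_mul, coeff_expand_mul,
    zero_add, map_add, show (3 : ℤ⟦X⟧) = C 3 from rfl, show (4 : ℤ⟦X⟧) = C 4 from rfl, coeff_C_mul,
    coeff_C_mul]

theorem B_three_four_mul_add_one (n : ℕ) : (B 3 (4 * n + 1) : ℤ) = 3 * B 3 (2 * n) := by
  rw [show 4 * n + 1 = 2 * (2 * n) + 1 by ring, B_three_two_mul_add_one]
  rcases n with _ | n
  · simp
  -- The correction series X·A(X²)³ has only odd powers, so it contributes nothing in even degree.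
  · rw [show 2 * (n + 1) = 2 * n + 1 + 1 by ring, coeff_succ_X_mul,
      coeff_expand_of_not_dvd _ _ _ (by omega)]
    ring

theorem B_three_four_mul_add_three (n : ℕ) :
    (B 3 (4 * n + 3) : ℤ) = 3 * B 3 (2 * n + 1) + 4 * B 3 n := by
  rw [show 4 * n + 3 = 2 * (2 * n + 1) + 1 by ring, B_three_two_mul_add_one, coeff_succ_X_mul,
    coeff_expand_mul, coeff_coreSeries_pow_three]

theorem B_three_two_pow_succ_succ (k m : ℕ) (hm : 0 < m) :
    (B 3 (2 ^ (k + 2) * m - 1) : ℚ) =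
      3 * B 3 (2 ^ (k + 1) * m - 1) + 4 * B 3 (2 ^ k * m - 1) := by
  have hpos : 0 < 2 ^ k * m := by positivity
  have h := B_three_four_mul_add_three (2 ^ k * m - 1)
  rw [show 4 * (2 ^ k * m - 1) + 3 = 2 ^ (k + 2) * m - 1 by
      rw [show 2 ^ (k + 2) * m = 4 * (2 ^ k * m) by ring]; omega,
    show 2 * (2 ^ k * m - 1) + 1 = 2 ^ (k + 1) * m - 1 by
      rw [show 2 ^ (k + 1) * m = 2 * (2 ^ k * m) by ring]; omega] at h
  exact_mod_cast h

/-- The solution of the recurrence `u (k + 2) = 3 * u (k + 1) + 4 * u k`. -/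
theorem eq_of_recurrence {u : ℕ → ℚ} (h : ∀ k, u (k + 2) = 3 * u (k + 1) + 4 * u k) (k : ℕ) :
    u (k + 1) = (2 ^ (2 * k + 2) + (-1) ^ k) / 5 * u 1 + (2 ^ (2 * k + 2) - 4 * (-1) ^ k) / 5 * u 0 := by
  induction k using Nat.twoStepInduction with
  | zero => norm_num
  | one => rw [h]; norm_num
  | more k h1 h2 => rw [h, h1, h2]; ring

end PartitionTriple

theorem mainTheorem1 (k : ℕ) (hk : 1 ≤ k) (n : ℕ) :
    (PartitionTriple.B 3 (2 ^ (k + 1) * n + 2 ^ k - 1) : ℚ) =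
        ((2 : ℚ) ^ (2 * k + 2) + (-1) ^ k) / 5 * (PartitionTriple.B 3 (2 * n) : ℚ) ∧
    (PartitionTriple.B 3 (2 ^ (k + 1) * n + 2 ^ (k + 1) - 1) : ℚ) =
        ((2 : ℚ) ^ (2 * k + 2) + (-1) ^ k) / 5 * (PartitionTriple.B 3 (2 * n + 1) : ℚ) +
          ((2 : ℚ) ^ (2 * k + 2) - 4 * (-1) ^ k) / 5 * (PartitionTriple.B 3 n : ℚ) := by
  constructor
  -- With m = 2n+1 the initial values are u_0 = B(2n) and u_1 = 3u_0, so the two coefficients merge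
  -- into the single one of index k + 1.
  · obtain ⟨k, rfl⟩ := Nat.exists_eq_add_of_le' hk
    have h := PartitionTriple.eq_of_recurrence
      (u := fun k => (PartitionTriple.B 3 (2 ^ k * (2 * n + 1) - 1) : ℚ))
      (fun k => PartitionTriple.B_three_two_pow_succ_succ k _ (by omega)) k
    have h1 : (PartitionTriple.B 3 (4 * n + 1) : ℚ) = 3 * PartitionTriple.B 3 (2 * n) := by
      exact_mod_cast PartitionTriple.B_three_four_mul_add_one n
    simp only [show 2 ^ 1 * (2 * n + 1) - 1 = 4 * n + 1 by omega,
      show 2 ^ 0 * (2 * n + 1) - 1 = 2 * n by omega, h1] at h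
    rw [show 2 ^ (k + 1 + 1) * n + 2 ^ (k + 1) = 2 ^ (k + 1) * (2 * n + 1) by ring, h]
    ring
  · have h := PartitionTriple.eq_of_recurrence
      (u := fun k => (PartitionTriple.B 3 (2 ^ k * (n + 1) - 1) : ℚ))
      (fun k => PartitionTriple.B_three_two_pow_succ_succ k _ (by omega)) k
    simp only [show 2 ^ 1 * (n + 1) - 1 = 2 * n + 1 by omega,
      show 2 ^ 0 * (n + 1) - 1 = n by omega] at h
    rw [← h, show 2 ^ (k + 1) * n + 2 ^ (k + 1) = 2 ^ (k + 1) * (n + 1) by ring]
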